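/- Let $(D_{n,k})_{n\ge 1,\,k\in\mathbb Z}$ be real random variables on a probability space $(\Omega,\mathcal A,P)$. Assume that for each fixed $n$ the sequence $(D_{n,k})_{k\in\mathbb Z}$ is strictly stationary and is a martingale difference sequence with respect to some filtration $(\mathcal F_{n,k})_{k\in\mathbb Z}$, i.e. $\mathcal F_{n,k}\subseteq\mathcal F_{n,k+1}\subseteq\mathcal A$, $D_{n,k}$ is $\mathcal F_{n,k}$-measurable and integrable, and $E(D_{n,k}\mid\mathcal F_{n,k-1})=0$ almost surely for all $k\in\mathbb Z$. Assume that the family $(D_{n,1}^2)_{n\ge1}$ is uniformly integrable. Let $(L_j)_{j\ge1}$ be a sequence of real random variables on some probability space and $c\in\mathbb R$ a constant such that, for every fixed $m\ge1$, the random vectors $(D_{n,1},\dots,D_{n,m})$ converge in distribution to $(L_1,\dots,L_m)$ as $n\to\infty$, and such that $$\frac1m\sum_{j=1}^m L_j^2\to c^2\quad\text{in }L^1\text{ as }m\to\infty.$$ Then $$\frac1{\sqrt n}\sum_{k=1}^n D_{n,k}\Rightarrow cZ\quad\text{as }n\to\infty,$$ where $Z$ is a standard normal random variable and $\Rightarrow$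 denotes convergence in distribution. -/

import Mathlib

open MeasureTheory ProbabilityTheory Filter
open scoped Topology

/-- `(X k)_{k ∈ ℤ}` is (strictly) stationary under `μ`: every time shift of the sequence has the
same law on `ℤ → ℝ` (with the product σ-algebra) as the sequence itself. -/
def IsStationarySequence {Ω : Type*} {mΩ : MeasurableSpace Ω} (X : ℤ → Ω → ℝ) (μ : Measure Ω) :
    Prop :=
  ∀ h : ℤ, IdentDistrib (fun ω (k : ℤ) => X (k + h) ω) (fun ω (k : ℤ) => X k ω) μ μ

/-- `(D k)_{k ∈ ℤ}` is a martingale difference sequence with respect to the filtration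
`(ℱ k)_{k ∈ ℤ}`: it is adapted, integrable and `E[D k | ℱ (k - 1)] = 0` almost surely. -/
structure IsMartingaleDifferenceSequence {Ω : Type*} {mΩ : MeasurableSpace Ω}
    (D : ℤ → Ω → ℝ) (ℱ : Filtration ℤ mΩ) (μ : Measure Ω) : Prop where
  adapted : ∀ k : ℤ, Measurable[ℱ k] (D k)
  integrable : ∀ k : ℤ, Integrable (D k) μ
  condExp_eq_zero : ∀ k : ℤ, μ[D k | ℱ (k - 1)] =ᵐ[μ] 0

/-! By Lévy's continuity theorem it suffices that the characteristic function at `t` tends to `exp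
(-t²c²/2)`. The argument is McLeish's. With `g = halfCappedSq`, one has `exp (ix + g x) = 1 + ix +
O(min (|x|³, x²))`, because `g` cancels the second-order term. Conditioning removes the linear term,
so `exp (iS + G)`, with `G` the sum of the `g` terms, has expectation 1 up to the Lindeberg sum.
Stopping once `G` exceeds a level keeps this process bounded, as the cap on `g` limits the
overshoot. If `G` is close in `L¹` to a constant `a`, then `E exp (iS)` is close to `exp (-a)`: this
is `norm_integral_exp_sum_sub_exp_le`.

Two inputs remain. The Lindeberg condition follows from uniform integrability
(`tendsto_nat_mul_integral_lindebergRem`). The `L¹` law of large numbers for the squares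
(`tendsto_integral_abs_mean_sq_sub`) comes from averaging over blocks of fixed length `m`: by
stationarity all blocks have the same law, weak convergence with uniform integrability compares one
block to the limit sequence, and there the mean is near `c²` for large `m`. -/

/-- Half of the square of `x`, capped at `1 / 2`. -/
noncomputable def halfCappedSq (x : ℝ) : ℝ := min (x ^ 2) 1 / 2

/-- The Lindeberg-type remainder `min (|x| ^ 3) (x ^ 2)`. -/
noncomputable def lindebergRem (x : ℝ) : ℝ := x ^ 2 * min |x| 1

/-! ### Pointwise estimates for the compensated exponential. -/

lemma halfCappedSq_nonneg (x : ℝ) : 0 ≤ halfCappedSq x := by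
  unfold halfCappedSq; positivity

lemma halfCappedSq_le_half (x : ℝ) : halfCappedSq x ≤ 1 / 2 := by
  unfold halfCappedSq; linarith [min_le_right (x ^ 2) 1]

lemma continuous_halfCappedSq : Continuous halfCappedSq := by unfold halfCappedSq; fun_prop

lemma continuous_lindebergRem : Continuous lindebergRem := by unfold lindebergRem; fun_prop

@[fun_prop] lemma measurable_halfCappedSq : Measurable halfCappedSq :=
  continuous_halfCappedSq.measurable

@[fun_prop] lemma measurable_lindebergRem : Measurable lindebergRem :=
  continuous_lindebergRem.measurable

lemma lindebergRem_nonneg (x : ℝ) : 0 ≤ lindebergRem x := by unfold lindebergRem; positivity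

lemma lindebergRem_le_sq (x : ℝ) : lindebergRem x ≤ x ^ 2 := by
  unfold lindebergRem
  exact mul_le_of_le_one_right (sq_nonneg x) (min_le_right _ _)

lemma abs_halfCappedSq_sub_le (x : ℝ) : |halfCappedSq x - x ^ 2 / 2| ≤ lindebergRem x := by
  unfold halfCappedSq lindebergRem
  rcases le_total |x| 1 with h | h
  · rw [min_eq_left ((sq_le_one_iff_abs_le_one x).2 h)]
    simp only [sub_self, abs_zero]; positivity
  · have h2 : 1 ≤ x ^ 2 := (one_le_sq_iff_one_le_abs x).2 h
    rw [min_eq_right h2, min_eq_right h, abs_le]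
    constructor <;> linarith

/-- For `|x| ≤ 1`, put `z = ix + x²/2`: the real part of order `x²` in `1 + z + z²/2` vanishes,
leaving terms of order three and higher. For `|x| ≥ 1` the left side is at most `4 + |x|`. -/
lemma norm_exp_sub_one_sub_le (x : ℝ) :
    ‖Complex.exp (Complex.I * x + halfCappedSq x) - 1 - Complex.I * x‖ ≤ 20 * lindebergRem x := by
  unfold lindebergRem
  rcases le_total |x| 1 with h | h
  · rw [min_eq_left h]
    have hg : halfCappedSq x = x ^ 2 / 2 := by
      rw [halfCappedSq, min_eq_left ((sq_le_one_iff_abs_le_one x).2 h)]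
    rw [hg]
    set z : ℂ := Complex.I * x + ((x ^ 2 / 2 : ℝ) : ℂ) with hz
    have hI := Complex.I_sq
    have hzn : ‖z‖ ≤ 3 / 2 * |x| := by
      refine (norm_add_le _ _).trans ?_
      rw [norm_mul, Complex.norm_I, Complex.norm_real, Complex.norm_real, Real.norm_eq_abs,
        Real.norm_eq_abs, abs_of_nonneg (by positivity : 0 ≤ x ^ 2 / 2), ← sq_abs]
      nlinarith [abs_nonneg x]
    have h1 := Complex.norm_exp_sub_sum_le_norm_mul_exp z 3
    simp only [Finset.sum_range_succ, Finset.sum_range_zero, Nat.factorial] at h1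
    have he : Real.exp ‖z‖ ≤ 5 := by
      calc Real.exp ‖z‖ ≤ Real.exp (3 / 2) := Real.exp_le_exp.2 (by linarith)
        _ ≤ 5 := by
          have h3 : Real.exp (3 / 2) ^ 2 = Real.exp 1 ^ 3 := by
            rw [← Real.exp_nat_mul, ← Real.exp_nat_mul]; norm_num
          have h4 : Real.exp 1 ^ 3 ≤ 2.72 ^ 3 := by
            gcongr; linarith [Real.exp_one_lt_d9]
          nlinarith [Real.exp_pos (3 / 2)]
    have hsplit : Complex.exp z - 1 - Complex.I * x =
        (Complex.exp z - (1 + z + z ^ 2 / 2)) + (Complex.I * x ^ 3 / 2 + x ^ 4 / 8) := by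
      rw [hz]; push_cast; linear_combination ((x : ℂ) ^ 2 / 2) * hI
    have hx : ‖(Complex.I * x ^ 3 / 2 + x ^ 4 / 8 : ℂ)‖ ≤ |x| ^ 3 := by
      refine (norm_add_le _ _).trans ?_
      simp only [norm_div, norm_mul, norm_pow, Complex.norm_I, Complex.norm_real, Real.norm_eq_abs]
      norm_num
      have : |x| ^ 4 ≤ |x| ^ 3 := pow_le_pow_of_le_one (abs_nonneg x) h (by norm_num)
      have : 0 ≤ |x| ^ 3 := by positivity
      linarith
    have h2 : ‖Complex.exp z - (1 + z + z ^ 2 / 2)‖ ≤ ‖z‖ ^ 3 * Real.exp ‖z‖ := by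
      convert h1 using 3; norm_num
    -- The constant 20 has room: `(3/2)³ · 5 < 17`, and `hx` adds 1.
    have h5 : ‖z‖ ^ 3 * Real.exp ‖z‖ ≤ (3 / 2 * |x|) ^ 3 * 5 := by gcongr
    rw [hsplit]
    refine (norm_add_le _ _).trans ?_
    have h6 : x ^ 2 * |x| = |x| ^ 3 := by rw [← sq_abs]; ring
    have : 0 ≤ |x| ^ 3 := by positivity
    rw [h6]
    nlinarith
  · have h2 : 1 ≤ x ^ 2 := (one_le_sq_iff_one_le_abs x).2 h
    rw [min_eq_right h, mul_one]
    have he : ‖Complex.exp (Complex.I * x + halfCappedSq x)‖ ≤ 3 := by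
      rw [Complex.norm_exp]
      simp only [Complex.add_re, Complex.mul_re, Complex.I_re, Complex.I_im, Complex.ofReal_re,
        Complex.ofReal_im, zero_mul, mul_zero, sub_zero, zero_add]
      have : Real.exp (halfCappedSq x) ≤ Real.exp 1 :=
        Real.exp_le_exp.2 (by linarith [halfCappedSq_le_half x])
      linarith [Real.exp_one_lt_d9]
    have h3 : ‖Complex.exp (Complex.I * x + halfCappedSq x) - 1 - Complex.I * x‖ ≤ 3 + 1 + |x| := by
      refine (norm_sub_le _ _).trans ?_
      rw [norm_mul, Complex.norm_I, Complex.norm_real, Real.norm_eq_abs, one_mul]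
      gcongr
      refine (norm_sub_le _ _).trans ?_
      rw [norm_one]; gcongr
    have : |x| ≤ x ^ 2 := by rw [← sq_abs]; nlinarith
    linarith

lemma abs_one_sub_exp_le {x b : ℝ} (hb : 0 ≤ b) (hx : x ≤ b) :
    |1 - Real.exp x| ≤ Real.exp b * |x| := by
  have h1 : 1 ≤ Real.exp b := Real.one_le_exp hb
  rcases le_total 0 x with h | h
  · rw [abs_of_nonpos (by linarith [Real.one_le_exp h]), abs_of_nonneg h]
    have h2 := Real.add_one_le_exp (-x)
    have h3 : Real.exp x * Real.exp (-x) = 1 := by rw [← Real.exp_add]; simp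
    have h4 : Real.exp x ≤ Real.exp b := Real.exp_le_exp.2 hx
    nlinarith [Real.exp_pos x]
  · rw [abs_of_nonneg (by linarith [Real.exp_le_one_iff.2 h]), abs_of_nonpos h]
    nlinarith [Real.add_one_le_exp x]

/-! ### The stopped exponential process and McLeish's inequality. -/

/-- Stopping a sum of numbers at most `1 / 2` once it exceeds `b` keeps it below `b + 1 / 2`. -/
lemma sum_stopped_le {v : ℕ → ℝ} (hv0 : ∀ k, 0 ≤ v k) (hv : ∀ k, v k ≤ 1 / 2) {b : ℝ} (hb : 0 ≤ b)
    (n : ℕ) : ∑ k ∈ Finset.range n, (if ∑ j ∈ Finset.range k, v j ≤ b then v k else 0) ≤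
      b + 1 / 2 := by
  induction n with
  | zero => simp; linarith
  | succ n ih =>
    rw [Finset.sum_range_succ]
    split_ifs with h
    · have : ∑ k ∈ Finset.range n, (if ∑ j ∈ Finset.range k, v j ≤ b then v k else 0) ≤
          ∑ k ∈ Finset.range n, v k := by
        refine Finset.sum_le_sum fun k _ => ?_
        split_ifs
        exacts [le_rfl, hv0 k]
      linarith [hv n]
    · simpa using ih

lemma integral_smul_eq_zero_of_condExp_eq_zero {Ω : Type*} {m mΩ : MeasurableSpace Ω}
    {μ : Measure Ω} [IsFiniteMeasure μ] (hm : m ≤ mΩ) {Y : Ω → ℝ} {W : Ω → ℂ}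
    (hY : Integrable Y μ) (hY0 : μ[Y | m] =ᵐ[μ] 0) (hW : Measurable[m] W)
    (hYW : Integrable (Y • W) μ) : ∫ ω, Y ω • W ω ∂μ = 0 := by
  have h1 := condExp_smul_of_aestronglyMeasurable_right hY hYW
    hW.stronglyMeasurable.aestronglyMeasurable
  have h2 : ∫ ω, (Y • W) ω ∂μ = 0 := by
    rw [← integral_condExp hm, integral_eq_zero_of_ae]
    filter_upwards [h1, hY0] with ω h h'
    simp [h, h']
  exact h2

/-- Indicator that the capped quadratic variation before time `k` is at most `b`. -/
noncomputable def goOn {Ω : Type*} (Y : ℕ → Ω → ℝ) (b : ℝ) (k : ℕ) (ω : Ω) : ℝ :=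
  if ∑ j ∈ Finset.range k, halfCappedSq (Y j ω) ≤ b then 1 else 0

/-- The stopped exponential process `exp (i S + G)`, `S` being the sum and `G` the capped quadratic
variation. -/
noncomputable def stoppedExp {Ω : Type*} (Y : ℕ → Ω → ℝ) (b : ℝ) (k : ℕ) (ω : Ω) : ℂ :=
  Complex.exp (Complex.I * (∑ j ∈ Finset.range k, goOn Y b j ω * Y j ω : ℝ) +
    (∑ j ∈ Finset.range k, goOn Y b j ω * halfCappedSq (Y j ω) : ℝ))

section

variable {Ω : Type*} {Y : ℕ → Ω → ℝ} {b : ℝ}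

lemma measurable_goOn [MeasurableSpace Ω] {k : ℕ} (hY : ∀ j < k, Measurable (Y j)) :
    Measurable (goOn Y b k) := by
  have h : Measurable fun ω => ∑ j ∈ Finset.range k, halfCappedSq (Y j ω) :=
    Finset.measurable_fun_sum _ fun j hj =>
      measurable_halfCappedSq.comp (hY j (Finset.mem_range.1 hj))
  exact Measurable.ite (measurableSet_le h measurable_const) measurable_const measurable_const

lemma measurable_stoppedExp [MeasurableSpace Ω] {k : ℕ} (hY : ∀ j < k, Measurable (Y j)) :
    Measurable (stoppedExp Y b k) := by
  have hg : ∀ j < k, Measurable (goOn Y b j) := fun j hj =>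
    measurable_goOn fun i hi => hY i (hi.trans hj)
  have h1 : Measurable fun ω => ∑ j ∈ Finset.range k, goOn Y b j ω * Y j ω :=
    Finset.measurable_fun_sum _ fun j hj =>
      (hg j (Finset.mem_range.1 hj)).mul (hY j (Finset.mem_range.1 hj))
  have h2 : Measurable fun ω => ∑ j ∈ Finset.range k, goOn Y b j ω * halfCappedSq (Y j ω) :=
    Finset.measurable_fun_sum _ fun j hj => (hg j (Finset.mem_range.1 hj)).mul
      (measurable_halfCappedSq.comp (hY j (Finset.mem_range.1 hj)))
  unfold stoppedExp
  fun_prop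

lemma abs_goOn_le (k : ℕ) (ω : Ω) : |goOn Y b k ω| ≤ 1 := by
  unfold goOn; split_ifs <;> simp

lemma sum_goOn_mul_le (hb : 0 ≤ b) (k : ℕ) (ω : Ω) :
    ∑ j ∈ Finset.range k, goOn Y b j ω * halfCappedSq (Y j ω) ≤ b + 1 / 2 := by
  simpa only [goOn, ite_mul, one_mul, zero_mul] using
    sum_stopped_le (v := fun j => halfCappedSq (Y j ω)) (fun _ => halfCappedSq_nonneg _)
      (fun _ => halfCappedSq_le_half _) hb k

lemma norm_stoppedExp (k : ℕ) (ω : Ω) : ‖stoppedExp Y b k ω‖ =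
    Real.exp (∑ j ∈ Finset.range k, goOn Y b j ω * halfCappedSq (Y j ω)) := by
  rw [stoppedExp, Complex.norm_exp]
  congr 1
  simp only [Complex.add_re, Complex.mul_re, Complex.I_re, Complex.I_im,
    Complex.ofReal_re, Complex.ofReal_im]
  ring

lemma norm_stoppedExp_le (hb : 0 ≤ b) (k : ℕ) (ω : Ω) :
    ‖stoppedExp Y b k ω‖ ≤ Real.exp (b + 1 / 2) := by
  rw [norm_stoppedExp]
  exact Real.exp_le_exp.2 (sum_goOn_mul_le hb k ω)

lemma goOn_eq_one {n k : ℕ} {ω : Ω} (hk : k ≤ n)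
    (h : ∑ j ∈ Finset.range n, halfCappedSq (Y j ω) ≤ b) : goOn Y b k ω = 1 := by
  refine if_pos (le_trans ?_ h)
  exact Finset.sum_le_sum_of_subset_of_nonneg (Finset.range_mono hk)
    fun _ _ _ => halfCappedSq_nonneg _

/-- The increment splits into a predictable multiple of `Y k`, which integrates to zero, and a
Lindeberg remainder. As `goOn` is 0 or 1, it can be moved out of the exponential. -/
lemma stoppedExp_succ_sub (k : ℕ) (ω : Ω) : stoppedExp Y b (k + 1) ω - stoppedExp Y b k ω =
    Y k ω • (Complex.I * goOn Y b k ω * stoppedExp Y b k ω) +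
    goOn Y b k ω * stoppedExp Y b k ω *
      (Complex.exp (Complex.I * Y k ω + halfCappedSq (Y k ω)) - 1 - Complex.I * Y k ω) := by
  have h : stoppedExp Y b (k + 1) ω = stoppedExp Y b k ω *
      Complex.exp (Complex.I * (goOn Y b k ω * Y k ω : ℝ) +
        (goOn Y b k ω * halfCappedSq (Y k ω) : ℝ)) := by
    rw [stoppedExp, stoppedExp, ← Complex.exp_add, Finset.sum_range_succ, Finset.sum_range_succ]
    congr 1; push_cast; ring
  rw [h, Complex.real_smul]
  unfold goOn
  split_ifs
  · simp only [one_mul, Complex.ofReal_one]; ring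
  · simp

/-- If the capped variation `G` is at most `a + 1`, nothing has been stopped and the difference is
`exp (iS) (1 - exp (G - a))`. Otherwise `|G - a| ≥ 1`, so a constant bound suffices. -/
lemma norm_exp_sub_exp_mul_stoppedExp_le {a : ℝ} (ha : 0 ≤ a) (n : ℕ) (ω : Ω) :
    ‖Complex.exp (Complex.I * (∑ j ∈ Finset.range n, Y j ω : ℝ)) -
        (Real.exp (-a) : ℂ) * stoppedExp Y (a + 1) n ω‖ ≤
      Real.exp 2 * (a + 3) * |∑ j ∈ Finset.range n, halfCappedSq (Y j ω) - a| := by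
  set G := ∑ j ∈ Finset.range n, halfCappedSq (Y j ω) with hG
  have he2 : 1 ≤ Real.exp 2 := Real.one_le_exp (by norm_num)
  rcases le_or_gt G (a + 1) with h | h
  · have h1 (f : ℕ → ℝ) :
        ∑ j ∈ Finset.range n, goOn Y (a + 1) j ω * f j = ∑ j ∈ Finset.range n, f j :=
      Finset.sum_congr rfl fun j hj => by rw [goOn_eq_one (Finset.mem_range.1 hj).le h, one_mul]
    have h2 : stoppedExp Y (a + 1) n ω =
        Complex.exp (Complex.I * (∑ j ∈ Finset.range n, Y j ω : ℝ)) * Real.exp G := by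
      rw [stoppedExp, Complex.exp_add, Complex.ofReal_exp, hG, h1, h1]
    have h3 : Complex.exp (Complex.I * (∑ j ∈ Finset.range n, Y j ω : ℝ)) -
        (Real.exp (-a) : ℂ) * stoppedExp Y (a + 1) n ω =
        Complex.exp (Complex.I * (∑ j ∈ Finset.range n, Y j ω : ℝ)) *
          ((1 - Real.exp (G - a) : ℝ) : ℂ) := by
      rw [h2, sub_eq_add_neg G a, Real.exp_add]; push_cast; ring
    rw [h3, norm_mul, mul_comm Complex.I, Complex.norm_exp_ofReal_mul_I, one_mul,
      Complex.norm_real, Real.norm_eq_abs]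
    refine (abs_one_sub_exp_le (b := 2) (by norm_num) (by linarith)).trans ?_
    gcongr
    nlinarith
  · have h1 : 1 ≤ |G - a| := le_trans (by linarith) (le_abs_self _)
    have h2 : ‖(Real.exp (-a) : ℂ) * stoppedExp Y (a + 1) n ω‖ ≤ Real.exp 2 := by
      rw [norm_mul, Complex.norm_real, Real.norm_eq_abs, Real.abs_exp]
      calc _ ≤ Real.exp (-a) * Real.exp (a + 1 + 1 / 2) := by
              gcongr; exact norm_stoppedExp_le (by linarith) n ω
        _ ≤ Real.exp 2 := by rw [← Real.exp_add]; exact Real.exp_le_exp.2 (by linarith)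
    refine (norm_sub_le _ _).trans ?_
    rw [mul_comm Complex.I, Complex.norm_exp_ofReal_mul_I]
    have h3 : Real.exp 2 * 3 ≤ Real.exp 2 * (a + 3) * |G - a| := by
      rw [mul_assoc]; gcongr; nlinarith
    linarith

variable {mΩ : MeasurableSpace Ω} {μ : Measure Ω}

lemma integrable_lindebergRem {X : Ω → ℝ} (hX : AEMeasurable X μ)
    (hX2 : Integrable (fun ω => X ω ^ 2) μ) : Integrable (fun ω => lindebergRem (X ω)) μ := by
  refine hX2.mono' (measurable_lindebergRem.comp_aemeasurable hX).aestronglyMeasurable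
    (.of_forall fun ω => ?_)
  rw [Real.norm_eq_abs, abs_of_nonneg (lindebergRem_nonneg _)]
  exact lindebergRem_le_sq _

variable [IsProbabilityMeasure μ] {ℱ : Filtration ℕ mΩ}

lemma integrable_stoppedExp (hY : ∀ k, Measurable (Y k)) (hb : 0 ≤ b) (k : ℕ) :
    Integrable (stoppedExp Y b k) μ :=
  .of_bound (measurable_stoppedExp fun j _ => hY j).aestronglyMeasurable (Real.exp (b + 1 / 2))
    (.of_forall (norm_stoppedExp_le hb k))

/-- Telescoping from the initial value 1: each increment contributes only its remainder in
expectation. -/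
lemma norm_integral_stoppedExp_sub_one_le (hY : ∀ k, Measurable[ℱ (k + 1)] (Y k))
    (hYi : ∀ k, Integrable (Y k) μ) (hY2 : ∀ k, Integrable (fun ω => Y k ω ^ 2) μ)
    (hY0 : ∀ k, μ[Y k | ℱ k] =ᵐ[μ] 0) (hb : 0 ≤ b) (n : ℕ) :
    ‖∫ ω, stoppedExp Y b n ω ∂μ - 1‖ ≤
      20 * Real.exp (b + 1 / 2) * ∑ k ∈ Finset.range n, ∫ ω, lindebergRem (Y k ω) ∂μ := by
  have hYm : ∀ k, Measurable (Y k) := fun k => (hY k).mono (ℱ.le _) le_rfl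
  have hgo : ∀ k ω, ‖(goOn Y b k ω : ℂ) * stoppedExp Y b k ω‖ ≤ Real.exp (b + 1 / 2) := by
    intro k ω
    rw [norm_mul, Complex.norm_real, Real.norm_eq_abs]
    calc _ ≤ 1 * Real.exp (b + 1 / 2) :=
          mul_le_mul (abs_goOn_le k ω) (norm_stoppedExp_le hb k ω) (norm_nonneg _) zero_le_one
      _ = _ := one_mul _
  induction n with
  | zero => simp [stoppedExp]
  | succ n ih =>
    have hW : Measurable[ℱ n] fun ω => Complex.I * goOn Y b n ω * stoppedExp Y b n ω := by
      have hYn : ∀ j < n, Measurable[ℱ n] (Y j) := fun j hj =>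
        (hY j).mono (ℱ.mono hj) le_rfl
      have h1 := @measurable_goOn Ω Y b (ℱ n) n hYn
      have h2 := @measurable_stoppedExp Ω Y b (ℱ n) n hYn
      exact (measurable_const.mul (Complex.measurable_ofReal.comp h1)).mul h2
    have hWn : ∀ ω, ‖Complex.I * goOn Y b n ω * stoppedExp Y b n ω‖ ≤ Real.exp (b + 1 / 2) := by
      intro ω
      rw [mul_assoc, norm_mul, Complex.norm_I, one_mul]; exact hgo n ω
    -- Stopping matters here: the predictable factor is bounded, so integrability of `Y n` is
    -- enough.
    have hi1 : Integrable (Y n • fun ω => Complex.I * goOn Y b n ω * stoppedExp Y b n ω) μ :=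
      (hYi n).smul_bdd (Real.exp (b + 1 / 2))
        (hW.mono (ℱ.le n) le_rfl).aestronglyMeasurable (.of_forall hWn)
    have hz := integral_smul_eq_zero_of_condExp_eq_zero (ℱ.le n) (hYi n) (hY0 n) hW hi1
    have hi0 := integrable_stoppedExp (μ := μ) hYm hb n
    have hi2 := integrable_stoppedExp (μ := μ) hYm hb (n + 1)
    have hkey : ∫ ω, stoppedExp Y b (n + 1) ω ∂μ - ∫ ω, stoppedExp Y b n ω ∂μ =
        ∫ ω, goOn Y b n ω * stoppedExp Y b n ω * (Complex.exp (Complex.I * Y n ω +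
          halfCappedSq (Y n ω)) - 1 - Complex.I * Y n ω) ∂μ := by
      rw [← integral_sub hi2 hi0, ← sub_zero (∫ ω, _ ∂μ), ← hz]
      refine (integral_sub (hi2.sub hi0) hi1).symm.trans ?_
      refine integral_congr_ae (.of_forall fun ω => ?_)
      simp only [stoppedExp_succ_sub, Pi.sub_apply, Pi.smul_apply']
      ring
    have hbound : ‖∫ ω, stoppedExp Y b (n + 1) ω ∂μ - ∫ ω, stoppedExp Y b n ω ∂μ‖ ≤
        20 * Real.exp (b + 1 / 2) * ∫ ω, lindebergRem (Y n ω) ∂μ := by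
      rw [hkey, ← integral_const_mul]
      refine norm_integral_le_of_norm_le
        ((integrable_lindebergRem (hYm n).aemeasurable (hY2 n)).const_mul _)
        (.of_forall fun ω => ?_)
      rw [norm_mul]
      calc _ ≤ Real.exp (b + 1 / 2) * (20 * lindebergRem (Y n ω)) :=
            mul_le_mul (hgo n ω) (norm_exp_sub_one_sub_le _) (norm_nonneg _) (Real.exp_pos _).le
        _ = _ := by ring
    rw [Finset.sum_range_succ, mul_add]
    calc _ = ‖(∫ ω, stoppedExp Y b n ω ∂μ - 1) +
          (∫ ω, stoppedExp Y b (n + 1) ω ∂μ - ∫ ω, stoppedExp Y b n ω ∂μ)‖ := by congr 1; ring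
      _ ≤ _ := (norm_add_le _ _).trans (add_le_add ih hbound)

/-- Quantitative form of McLeish's martingale central limit theorem: the characteristic function of
a sum of martingale differences is close to `exp (-a)` when the Lindeberg terms are small and half
the sum of the squares is close to `a` in `L¹`. -/
theorem norm_integral_exp_sum_sub_exp_le (hY : ∀ k, Measurable[ℱ (k + 1)] (Y k))
    (hYi : ∀ k, Integrable (Y k) μ) (hY2 : ∀ k, Integrable (fun ω => Y k ω ^ 2) μ)
    (hY0 : ∀ k, μ[Y k | ℱ k] =ᵐ[μ] 0) {a : ℝ} (ha : 0 ≤ a) (n : ℕ) :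
    ‖∫ ω, Complex.exp (Complex.I * (∑ j ∈ Finset.range n, Y j ω : ℝ)) ∂μ - (Real.exp (-a) : ℂ)‖ ≤
      (20 * Real.exp (a + 2) + Real.exp 2 * (a + 3)) *
        (∑ k ∈ Finset.range n, ∫ ω, lindebergRem (Y k ω) ∂μ +
          ∫ ω, |∑ j ∈ Finset.range n, Y j ω ^ 2 / 2 - a| ∂μ) := by
  have hYm : ∀ k, Measurable (Y k) := fun k => (hY k).mono (ℱ.le _) le_rfl
  have hR : ∀ k, Integrable (fun ω => lindebergRem (Y k ω)) μ := fun k =>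
    integrable_lindebergRem (hYm k).aemeasurable (hY2 k)
  set R := ∑ k ∈ Finset.range n, ∫ ω, lindebergRem (Y k ω) ∂μ with hRdef
  set V := ∫ ω, |∑ j ∈ Finset.range n, Y j ω ^ 2 / 2 - a| ∂μ with hV
  have hR0 : 0 ≤ R := Finset.sum_nonneg fun k _ => integral_nonneg fun ω => lindebergRem_nonneg _
  have hV0 : 0 ≤ V := integral_nonneg fun ω => abs_nonneg _
  have hVi : Integrable (fun ω => |∑ j ∈ Finset.range n, Y j ω ^ 2 / 2 - a|) μ :=
    ((integrable_finsetSum _ fun j _ => (hY2 j).div_const 2).sub (integrable_const a)).abs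
  have hRi : Integrable (fun ω => ∑ k ∈ Finset.range n, lindebergRem (Y k ω)) μ :=
    integrable_finsetSum _ fun j _ => hR j
  have hM := integrable_stoppedExp (μ := μ) hYm (b := a + 1) (by linarith) n
  have hE : Integrable
      (fun ω => Complex.exp (Complex.I * (∑ j ∈ Finset.range n, Y j ω : ℝ))) μ := by
    refine .of_bound (Measurable.aestronglyMeasurable (by fun_prop)) 1 (.of_forall fun ω => ?_)
    rw [mul_comm Complex.I, Complex.norm_exp_ofReal_mul_I]
  have h1 : ‖∫ ω, Complex.exp (Complex.I * (∑ j ∈ Finset.range n, Y j ω : ℝ)) ∂μ -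
      (Real.exp (-a) : ℂ) * ∫ ω, stoppedExp Y (a + 1) n ω ∂μ‖ ≤
      Real.exp 2 * (a + 3) * (R + V) := by
    rw [← integral_const_mul, ← integral_sub hE (hM.const_mul _), hRdef,
      ← integral_finsetSum _ fun j _ => hR j, hV, ← integral_add hRi hVi, ← integral_const_mul]
    refine norm_integral_le_of_norm_le ((hRi.add hVi).const_mul _) (.of_forall fun ω => ?_)
    refine (norm_exp_sub_exp_mul_stoppedExp_le ha n ω).trans ?_
    gcongr
    -- Removing the cap costs one more Lindeberg sum.
    have h2 : |∑ j ∈ Finset.range n, halfCappedSq (Y j ω) - ∑ j ∈ Finset.range n, Y j ω ^ 2 / 2| ≤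
        ∑ k ∈ Finset.range n, lindebergRem (Y k ω) := by
      rw [← Finset.sum_sub_distrib]
      exact (Finset.abs_sum_le_sum_abs _ _).trans
        (Finset.sum_le_sum fun j _ => abs_halfCappedSq_sub_le _)
    exact (abs_sub_le _ _ _).trans (add_le_add_left h2 _)
  have h3 : ‖(Real.exp (-a) : ℂ) * ∫ ω, stoppedExp Y (a + 1) n ω ∂μ - (Real.exp (-a) : ℂ)‖ ≤
      20 * Real.exp (a + 2) * R := by
    have h4 := norm_integral_stoppedExp_sub_one_le hY hYi hY2 hY0 (b := a + 1) (by linarith) n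
    have h5 : (Real.exp (-a) : ℂ) * ∫ ω, stoppedExp Y (a + 1) n ω ∂μ - (Real.exp (-a) : ℂ) =
      (Real.exp (-a) : ℂ) * (∫ ω, stoppedExp Y (a + 1) n ω ∂μ - 1) := by ring
    rw [h5, norm_mul, Complex.norm_real, Real.norm_eq_abs, Real.abs_exp]
    calc _ ≤ 1 * (20 * Real.exp (a + 1 + 1 / 2) * R) :=
          mul_le_mul (Real.exp_le_one_iff.2 (by linarith)) h4 (norm_nonneg _) zero_le_one
      _ ≤ _ := by
        rw [one_mul]; gcongr 20 * ?_ * R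
        exact Real.exp_le_exp.2 (by linarith)
  calc _ ≤ Real.exp 2 * (a + 3) * (R + V) + 20 * Real.exp (a + 2) * R :=
        (norm_sub_le_norm_sub_add_norm_sub _ _ _).trans (add_le_add h1 h3)
    _ ≤ _ := by
      have : 0 ≤ 20 * Real.exp (a + 2) * V := by positivity
      linarith

end

/-! ### Uniform integrability and the Lindeberg condition. -/

section

variable {Ω : Type*} {mΩ : MeasurableSpace Ω} {μ : Measure Ω} [IsProbabilityMeasure μ]

lemma integrable_max_sub {f : Ω → ℝ} (hf : Integrable f μ) (A : ℝ) :
    Integrable (fun ω => max (f ω - A) 0) μ :=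
  (hf.sub (integrable_const A)).sup (integrable_zero _ _ _)

/-- The positive part above `A` is dominated by the usual indicator truncation. The extra
requirement `b ≤ A` serves the truncation in `abs_mean_sq_sub_le`. -/
lemma exists_forall_integral_max_sub_le {ι : Type*} {f : ι → Ω → ℝ}
    (hf : UniformIntegrable f 1 μ) (b : ℝ) {ε : ℝ} (hε : 0 < ε) :
    ∃ A, 0 ≤ A ∧ b ≤ A ∧ ∀ i, ∫ ω, max (f i ω - A) 0 ∂μ ≤ ε := by
  obtain ⟨C, hC⟩ := hf.spec one_ne_zero ENNReal.one_ne_top hε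
  refine ⟨max (C : ℝ) b, le_max_of_le_left C.2, le_max_right _ _, fun i => ?_⟩
  have hfi : Integrable (f i) μ := memLp_one_iff_integrable.1 (hf.memLp i)
  have hpt : ∀ ω, ‖max (f i ω - max (C : ℝ) b) 0‖ ≤ ‖{x | C ≤ ‖f i x‖₊}.indicator (f i) ω‖ := by
    intro ω
    rw [Real.norm_of_nonneg (le_max_right _ _)]
    by_cases h : C ≤ ‖f i ω‖₊
    · rw [Set.indicator_of_mem (by exact h)]
      refine max_le ?_ (norm_nonneg _)
      have h1 := le_max_left (C : ℝ) b
      have h2 : (0 : ℝ) ≤ C := C.2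
      have h3 := le_abs_self (f i ω)
      rw [Real.norm_eq_abs]; linarith
    · refine max_le ?_ (norm_nonneg _)
      have h1 := le_max_left (C : ℝ) b
      have h2 : ‖f i ω‖ < C := by exact_mod_cast not_le.1 h
      have h3 := le_abs_self (f i ω)
      rw [Real.norm_eq_abs] at h2
      linarith [norm_nonneg ({x | C ≤ ‖f i x‖₊}.indicator (f i) ω)]
  have h1 : eLpNorm (fun ω => max (f i ω - max (C : ℝ) b) 0) 1 μ ≤ ENNReal.ofReal ε :=
    (eLpNorm_mono hpt).trans (hC i)
  rw [eLpNorm_one_eq_lintegral_enorm, ← ofReal_integral_norm_eq_lintegral_enorm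
    (integrable_max_sub hfi _), ENNReal.ofReal_le_ofReal_iff hε.le] at h1
  refine le_trans (le_of_eq ?_) h1
  exact integral_congr_ae (.of_forall fun ω => (Real.norm_of_nonneg (le_max_right _ _)).symm)

lemma exists_forall_integral_le {ι : Type*} {f : ι → Ω → ℝ} (hf : UniformIntegrable f 1 μ) :
    ∃ B, 0 ≤ B ∧ ∀ i, ∫ ω, f i ω ∂μ ≤ B := by
  obtain ⟨A, hA, -, h⟩ := exists_forall_integral_max_sub_le hf 0 one_pos
  refine ⟨A + 1, by linarith, fun i => ?_⟩
  have hfi : Integrable (f i) μ := memLp_one_iff_integrable.1 (hf.memLp i)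
  calc ∫ ω, f i ω ∂μ ≤ ∫ ω, (A + max (f i ω - A) 0) ∂μ :=
        integral_mono hfi ((integrable_const A).add (integrable_max_sub hfi A)) fun ω => by
          dsimp only; linarith [le_max_left (f i ω - A) 0]
    _ = A + ∫ ω, max (f i ω - A) 0 ∂μ := by
        rw [integral_add (integrable_const A) (integrable_max_sub hfi A)]; simp
    _ ≤ A + 1 := by linarith [h i]

/-- Split `x² ≤ A + (x² - A)⁺` and bound the minimum by `|s x|` on the first part and by 1 on the
second. -/
lemma lindebergRem_mul_le (s x : ℝ) {A : ℝ} (hA : 0 ≤ A) :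
    lindebergRem (s * x) ≤ s ^ 2 * (A * |s| * (1 + x ^ 2) + max (x ^ 2 - A) 0) := by
  unfold lindebergRem
  rw [mul_pow, mul_assoc, abs_mul]
  gcongr
  have h0 : 0 ≤ min (|s| * |x|) 1 := by positivity
  have h1 : |x| ≤ 1 + x ^ 2 := by rw [← sq_abs]; nlinarith [sq_nonneg (|x| - 1), abs_nonneg x]
  calc x ^ 2 * min (|s| * |x|) 1 ≤ (A + max (x ^ 2 - A) 0) * min (|s| * |x|) 1 := by
        gcongr; linarith [le_max_left (x ^ 2 - A) 0]
    _ ≤ A * (|s| * |x|) + max (x ^ 2 - A) 0 * 1 := by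
        rw [add_mul]; gcongr
        exacts [min_le_left _ _, min_le_right _ _]
    _ ≤ _ := by
        rw [mul_one, mul_assoc]; gcongr

/-- The Lindeberg condition for variables with uniformly integrable squares. -/
lemma tendsto_nat_mul_integral_lindebergRem {X : ℕ → Ω → ℝ}
    (hUI : UniformIntegrable (fun n ω => X n ω ^ 2) 1 μ) (t : ℝ) :
    Tendsto (fun n : ℕ => n * ∫ ω, lindebergRem (t / √n * X n ω) ∂μ) atTop (𝓝 0) := by
  obtain ⟨B, hB0, hB⟩ := exists_forall_integral_le hUI
  have hX2 : ∀ n, Integrable (fun ω => X n ω ^ 2) μ := fun n =>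
    memLp_one_iff_integrable.1 (hUI.memLp n)
  -- The factor `n` cancels against `(t/√n)²`; the `A` term still decays like `1/√n`, and the tail
  -- is at most `ε` uniformly in `n`.
  have hbound : ∀ ε > 0, ∃ A, 0 ≤ A ∧ ∀ n : ℕ, 1 ≤ n →
      n * ∫ ω, lindebergRem (t / √n * X n ω) ∂μ ≤ t ^ 2 * (A * |t / √n| * (1 + B) + ε) := by
    intro ε hε
    obtain ⟨A, hA, -, h⟩ := exists_forall_integral_max_sub_le hUI 0 hε
    refine ⟨A, hA, fun n hn => ?_⟩
    have hn0 : (0 : ℝ) < n := by exact_mod_cast hn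
    have h2 : Integrable (fun ω => 1 + X n ω ^ 2) μ := (integrable_const 1).add (hX2 n)
    have h1 : ∫ ω, lindebergRem (t / √n * X n ω) ∂μ ≤
        (t / √n) ^ 2 * (A * |t / √n| * (1 + B) + ε) := by
      calc _ ≤ ∫ ω, (t / √n) ^ 2 * (A * |t / √n| * (1 + X n ω ^ 2) +
              max (X n ω ^ 2 - A) 0) ∂μ := by
            refine integral_mono_of_nonneg (.of_forall fun ω => lindebergRem_nonneg _)
              (((h2.const_mul _).add (integrable_max_sub (hX2 n) A)).const_mul _)
              (.of_forall fun ω => lindebergRem_mul_le _ _ hA)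
        _ = (t / √n) ^ 2 * (A * |t / √n| * (1 + ∫ ω, X n ω ^ 2 ∂μ) +
              ∫ ω, max (X n ω ^ 2 - A) 0 ∂μ) := by
            rw [integral_const_mul, integral_add (h2.const_mul _) (integrable_max_sub (hX2 n) A)]
            congr 2
            refine (integral_const_mul _ _).trans ?_
            congr 1
            refine (integral_add (integrable_const _) (hX2 n)).trans ?_
            simp
        _ ≤ _ := by
            gcongr
            exacts [hB n, h n]
    calc _ ≤ n * ((t / √n) ^ 2 * (A * |t / √n| * (1 + B) + ε)) := by gcongr
      _ = _ := by rw [div_pow, Real.sq_sqrt hn0.le]; field_simp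
  rw [Metric.tendsto_atTop]
  intro δ hδ
  obtain ⟨A, hA, h⟩ := hbound (δ / (2 * (t ^ 2 + 1))) (by positivity)
  have hs : Tendsto (fun n : ℕ => t ^ 2 * (A * |t / √n| * (1 + B) + δ / (2 * (t ^ 2 + 1)))) atTop
      (𝓝 (t ^ 2 * (A * |0| * (1 + B) + δ / (2 * (t ^ 2 + 1))))) := by
    have h0 : Tendsto (fun n : ℕ => t / √n) atTop (𝓝 0) :=
      (Real.tendsto_sqrt_atTop.comp tendsto_natCast_atTop_atTop).const_div_atTop t
    exact (((h0.abs.const_mul A).mul_const _).add_const _).const_mul _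
  have hlt : t ^ 2 * (A * |0| * (1 + B) + δ / (2 * (t ^ 2 + 1))) < δ := by
    rw [abs_zero, mul_zero, zero_mul, zero_add, ← mul_div_assoc, div_lt_iff₀ (by positivity)]
    nlinarith [sq_nonneg t]
  obtain ⟨N, hN⟩ := eventually_atTop.1 (hs.eventually_lt_const hlt)
  refine ⟨max N 1, fun n hn => ?_⟩
  have h3 := h n (le_of_max_le_right hn)
  have h4 := hN n (le_of_max_le_left hn)
  rw [Real.dist_eq, sub_zero, abs_of_nonneg]
  · linarith
  · exact mul_nonneg n.cast_nonneg (integral_nonneg fun ω => lindebergRem_nonneg _)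

end

/-! ### Block averaging and the law of large numbers for squares. -/

lemma sum_range_shift (q : ℕ → ℝ) (n j : ℕ) : ∑ k ∈ Finset.range n, q (k + j) =
    ∑ k ∈ Finset.range n, q k + (∑ i ∈ Finset.range j, q (n + i) - ∑ i ∈ Finset.range j, q i) := by
  have h1 := Finset.sum_range_add q n j
  have h2 := Finset.sum_range_add q j n
  rw [add_comm j n] at h2
  simp only [add_comm j] at h2
  linarith

/-- The mean of `q` over `n` indices is controlled by its means over blocks of length `m`. -/
lemma abs_mean_sub_le {q : ℕ → ℝ} (hq : ∀ k, 0 ≤ q k) (b : ℝ) {m n : ℕ} (hm : 1 ≤ m) (hn : 1 ≤ n) :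
    |1 / (n : ℝ) * ∑ k ∈ Finset.range n, q k - b| ≤
      1 / (n : ℝ) * (∑ k ∈ Finset.range n, |1 / (m : ℝ) * ∑ j ∈ Finset.range m, q (k + j) - b| +
        ∑ j ∈ Finset.range m, (q j + q (n + j))) := by
  have hm0 : (0 : ℝ) < m := by exact_mod_cast hm
  have hn0 : (0 : ℝ) < n := by exact_mod_cast hn
  set E := ∑ j ∈ Finset.range m, (q j + q (n + j)) with hE
  -- A shift by `j < m` changes the sum only at its two ends, and `E` dominates both changes.
  have hshift : ∀ j ∈ Finset.range m,
      |∑ k ∈ Finset.range n, q k - ∑ k ∈ Finset.range n, q (k + j)| ≤ E := by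
    intro j hj
    have hjm : Finset.range j ⊆ Finset.range m := Finset.range_mono (Finset.mem_range.1 hj).le
    have h1 : ∑ i ∈ Finset.range j, q (n + i) ≤ ∑ i ∈ Finset.range m, q (n + i) :=
      Finset.sum_le_sum_of_subset_of_nonneg hjm fun _ _ _ => hq _
    have h2 : ∑ i ∈ Finset.range j, q i ≤ ∑ i ∈ Finset.range m, q i :=
      Finset.sum_le_sum_of_subset_of_nonneg hjm fun _ _ _ => hq _
    have h3 : 0 ≤ ∑ i ∈ Finset.range j, q (n + i) := Finset.sum_nonneg fun _ _ => hq _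
    have h4 : 0 ≤ ∑ i ∈ Finset.range j, q i := Finset.sum_nonneg fun _ _ => hq _
    rw [sum_range_shift, hE, Finset.sum_add_distrib, abs_le]
    constructor <;> linarith
  have hdiff : |∑ k ∈ Finset.range n, q k -
      ∑ k ∈ Finset.range n, 1 / (m : ℝ) * ∑ j ∈ Finset.range m, q (k + j)| ≤ E := by
    rw [← Finset.mul_sum, Finset.sum_comm]
    have h1 : ∑ k ∈ Finset.range n, q k - 1 / (m : ℝ) * ∑ j ∈ Finset.range m,
        ∑ k ∈ Finset.range n, q (k + j) = 1 / (m : ℝ) * ∑ j ∈ Finset.range m,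
          (∑ k ∈ Finset.range n, q k - ∑ k ∈ Finset.range n, q (k + j)) := by
      rw [Finset.sum_sub_distrib, Finset.sum_const, Finset.card_range, nsmul_eq_mul]
      field_simp
    rw [h1, abs_mul, abs_of_pos (by positivity)]
    calc _ ≤ 1 / (m : ℝ) * ∑ j ∈ Finset.range m, E := by
          gcongr
          exact (Finset.abs_sum_le_sum_abs _ _).trans (Finset.sum_le_sum hshift)
      _ = E := by rw [Finset.sum_const, Finset.card_range, nsmul_eq_mul]; field_simp
  have hsplit : 1 / (n : ℝ) * ∑ k ∈ Finset.range n, q k - b = 1 / (n : ℝ) *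
      (∑ k ∈ Finset.range n, (1 / (m : ℝ) * ∑ j ∈ Finset.range m, q (k + j) - b) +
        (∑ k ∈ Finset.range n, q k -
          ∑ k ∈ Finset.range n, 1 / (m : ℝ) * ∑ j ∈ Finset.range m, q (k + j))) := by
    rw [Finset.sum_sub_distrib, Finset.sum_const, Finset.card_range, nsmul_eq_mul]
    field_simp
    ring
  rw [hsplit, abs_mul, abs_of_pos (by positivity : 0 < 1 / (n : ℝ))]
  gcongr
  exact (abs_add_le _ _).trans (add_le_add (Finset.abs_sum_le_sum_abs _ _) hdiff)

section

variable {Ω : Type*} {mΩ : MeasurableSpace Ω} {μ : Measure Ω}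

/-- Below, the deviation is at least `-b ≥ -A`; above, the mean exceeds `A` by at most the mean
tail. Capping at `A` thus loses only the tail. -/
lemma abs_mean_sq_sub_le {m : ℕ} (hm : 1 ≤ m) (x : Fin m → ℝ) {A b : ℝ} (hb : 0 ≤ b)
    (hbA : b ≤ A) : |1 / (m : ℝ) * ∑ i, x i ^ 2 - b| ≤
      min |1 / (m : ℝ) * ∑ i, x i ^ 2 - b| A + 1 / (m : ℝ) * ∑ i, max (x i ^ 2 - A) 0 := by
  have hm0 : (0 : ℝ) < m := by exact_mod_cast hm
  have h0 : 0 ≤ 1 / (m : ℝ) * ∑ i, max (x i ^ 2 - A) 0 :=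
    mul_nonneg (by positivity) (Finset.sum_nonneg fun _ _ => le_max_right _ _)
  have h1 : 0 ≤ 1 / (m : ℝ) * ∑ i, x i ^ 2 := by positivity
  have h2 : 1 / (m : ℝ) * ∑ i, x i ^ 2 ≤ A + 1 / (m : ℝ) * ∑ i, max (x i ^ 2 - A) 0 := by
    have h3 : A + 1 / (m : ℝ) * ∑ i, max (x i ^ 2 - A) 0 =
        1 / (m : ℝ) * ∑ i, (A + max (x i ^ 2 - A) 0) := by
      rw [Finset.sum_add_distrib, Finset.sum_const, Finset.card_univ, Fintype.card_fin,
        nsmul_eq_mul]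
      field_simp
    rw [h3]
    gcongr with i
    linarith [le_max_left (x i ^ 2 - A) 0]
  rcases le_total |1 / (m : ℝ) * ∑ i, x i ^ 2 - b| A with h | h
  · rw [min_eq_left h]; linarith
  · rw [min_eq_right h, abs_le]; constructor <;> linarith

/-- Under convergence in distribution, the limit superior of the expectations of `|mean of squares -
b|` is controlled by the same expectation for the limit, up to a tail term. -/
lemma eventually_integral_abs_mean_sq_sub_le [IsProbabilityMeasure μ] {Ω' : Type*}
    {mΩ' : MeasurableSpace Ω'}
    {μ' : Measure Ω'} [IsProbabilityMeasure μ'] {m : ℕ} (hm : 1 ≤ m) {X : ℕ → Ω → Fin m → ℝ}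
    {L : Ω' → Fin m → ℝ} (hXL : TendstoInDistribution X atTop L (fun _ => μ) μ')
    (hX2 : ∀ n i, Integrable (fun ω => X n ω i ^ 2) μ) {A b ε δ : ℝ} (hb : 0 ≤ b) (hbA : b ≤ A)
    (hA : ∀ n i, ∫ ω, max (X n ω i ^ 2 - A) 0 ∂μ ≤ ε)
    (hδ : 0 < δ)
    (hL : ∫⁻ ω, ‖1 / (m : ℝ) * ∑ i, L ω i ^ 2 - b‖ₑ ∂μ' ≤ ENNReal.ofReal δ) :
    ∀ᶠ n in atTop, ∫ ω, |1 / (m : ℝ) * ∑ i, X n ω i ^ 2 - b| ∂μ ≤ ε + 2 * δ := by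
  have hm0 : (0 : ℝ) < m := by exact_mod_cast hm
  have hA0 : 0 ≤ A := hb.trans hbA
  let φ : (Fin m → ℝ) → ℝ := fun x => |1 / (m : ℝ) * ∑ i, x i ^ 2 - b|
  have hφc : Continuous φ := by fun_prop
  -- The cap turns the deviation into an admissible test function for weak convergence.
  let F : BoundedContinuousFunction (Fin m → ℝ) ℝ :=
    BoundedContinuousFunction.ofNormedAddCommGroup (fun x => min (φ x) A)
      (hφc.min continuous_const) A (fun x => by
        rw [Real.norm_of_nonneg (le_min (abs_nonneg _) hA0)]; exact min_le_right _ _)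
  have hF : ∀ x, F x = min (φ x) A := fun x => rfl
  have hlim := (ProbabilityMeasure.tendsto_iff_forall_integral_tendsto.1 hXL.tendsto) F
  simp only [ProbabilityMeasure.coe_mk] at hlim
  rw [integral_map hXL.aemeasurable_limit F.continuous.measurable.aestronglyMeasurable] at hlim
  have hLint : ∫ ω, F (L ω) ∂μ' ≤ δ := by
    have h1 : ∫⁻ ω, ‖F (L ω)‖ₑ ∂μ' ≤ ENNReal.ofReal δ := by
      refine (lintegral_mono fun ω => ?_).trans hL
      refine enorm_le_iff_norm_le.2 ?_
      rw [hF, Real.norm_of_nonneg (le_min (abs_nonneg _) hA0)]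
      exact min_le_left _ _
    have hi : Integrable (fun ω => F (L ω)) μ' :=
      .of_bound (F.continuous.measurable.comp_aemeasurable
        hXL.aemeasurable_limit).aestronglyMeasurable ‖F‖ (.of_forall fun ω => F.norm_coe_le_norm _)
    rw [← ofReal_integral_norm_eq_lintegral_enorm hi, ENNReal.ofReal_le_ofReal_iff hδ.le] at h1
    exact (le_abs_self _).trans ((norm_integral_le_integral_norm _).trans h1)
  filter_upwards [hlim.eventually_lt_const (show _ < 2 * δ by linarith)] with n hn
  rw [integral_map (hXL.forall_aemeasurable n)
    F.continuous.measurable.aestronglyMeasurable] at hn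
  have hi : Integrable (fun ω => F (X n ω)) μ :=
    .of_bound (F.continuous.measurable.comp_aemeasurable
      (hXL.forall_aemeasurable n)).aestronglyMeasurable ‖F‖
      (.of_forall fun ω => F.norm_coe_le_norm _)
  have hmax := fun i => integrable_max_sub (hX2 n i) A
  have hi2 : Integrable (fun ω => 1 / (m : ℝ) * ∑ i, max (X n ω i ^ 2 - A) 0) μ :=
    (integrable_finsetSum _ fun i _ => hmax i).const_mul _
  have h2 : ∫ ω, 1 / (m : ℝ) * ∑ i, max (X n ω i ^ 2 - A) 0 ∂μ ≤ ε := by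
    rw [integral_const_mul, integral_finsetSum _ fun i _ => hmax i]
    calc _ ≤ 1 / (m : ℝ) * ∑ i : Fin m, ε := by gcongr with i; exact hA n i
      _ = ε := by
        rw [Finset.sum_const, Finset.card_univ, Fintype.card_fin, nsmul_eq_mul]; field_simp
  calc _ ≤ ∫ ω, (F (X n ω) + 1 / (m : ℝ) * ∑ i, max (X n ω i ^ 2 - A) 0) ∂μ :=
        integral_mono_of_nonneg (.of_forall fun ω => abs_nonneg _) (hi.add hi2)
          (.of_forall fun ω => abs_mean_sq_sub_le hm _ hb hbA)
    _ = _ := integral_add hi hi2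
    _ ≤ _ := by linarith

lemma IsStationarySequence.identDistrib_comp {X : ℤ → Ω → ℝ} (hX : IsStationarySequence X μ)
    {γ : Type*} [MeasurableSpace γ] {u : (ℤ → ℝ) → γ} (hu : Measurable u) (h : ℤ) :
    IdentDistrib (fun ω => u fun k => X (k + h) ω) (fun ω => u fun k => X k ω) μ μ :=
  (hX h).comp hu

lemma IsStationarySequence.identDistrib_one {X : ℤ → Ω → ℝ} (hX : IsStationarySequence X μ)
    (k : ℤ) : IdentDistrib (X k) (X 1) μ μ := by
  have h := hX.identDistrib_comp (measurable_pi_apply 1) (k - 1)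
  simpa using h

/-- Integrate `abs_mean_sub_le`: all `n` blocks have the same expected deviation, and the boundary
consists of `2m` squares divided by `n`. -/
lemma IsStationarySequence.integral_abs_mean_sq_sub_le {X : ℤ → Ω → ℝ}
    [IsProbabilityMeasure μ]
    (hX : IsStationarySequence X μ) (hX2 : Integrable (fun ω => X 1 ω ^ 2) μ) (b : ℝ) {m n : ℕ}
    (hm : 1 ≤ m) (hn : 1 ≤ n) :
    ∫ ω, |1 / (n : ℝ) * ∑ k ∈ Finset.range n, X (k + 1) ω ^ 2 - b| ∂μ ≤
      ∫ ω, |1 / (m : ℝ) * ∑ j ∈ Finset.range m, X (j + 1) ω ^ 2 - b| ∂μ +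
        2 * m / n * ∫ ω, X 1 ω ^ 2 ∂μ := by
  have hn0 : (0 : ℝ) < n := by exact_mod_cast hn
  have hi : ∀ k : ℕ, Integrable (fun ω => X (k + 1) ω ^ 2) μ := fun k =>
    (hX.identDistrib_one (k + 1)).sq.symm.integrable_snd hX2
  have he : ∀ k : ℕ, ∫ ω, X (k + 1) ω ^ 2 ∂μ = ∫ ω, X 1 ω ^ 2 ∂μ := fun k =>
    (hX.identDistrib_one (k + 1)).sq.integral_eq
  have hbi : ∀ k : ℕ, Integrable (fun ω =>
      |1 / (m : ℝ) * ∑ j ∈ Finset.range m, X ((k + j : ℕ) + 1) ω ^ 2 - b|) μ := fun k =>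
    (((integrable_finsetSum _ fun j _ => hi (k + j)).const_mul _).sub (integrable_const b)).abs
  have hbe : ∀ k : ℕ,
      ∫ ω, |1 / (m : ℝ) * ∑ j ∈ Finset.range m, X ((k + j : ℕ) + 1) ω ^ 2 - b| ∂μ =
        ∫ ω, |1 / (m : ℝ) * ∑ j ∈ Finset.range m, X (j + 1) ω ^ 2 - b| ∂μ := by
    intro k
    have hu : Measurable fun x : ℤ → ℝ =>
        |1 / (m : ℝ) * ∑ j ∈ Finset.range m, x (j + 1) ^ 2 - b| := by fun_prop
    have h := (hX.identDistrib_comp hu k).integral_eq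
    rw [← h]
    congr with ω
    congr 3
    refine Finset.sum_congr rfl fun j _ => ?_
    congr 2
    push_cast; ring
  have hsi : ∀ j : ℕ,
      Integrable (fun ω => X (j + 1) ω ^ 2 + X ((n + j : ℕ) + 1) ω ^ 2) μ := fun j =>
    (hi j).add (hi (n + j))
  have hEi : Integrable (fun ω =>
      ∑ j ∈ Finset.range m, (X (j + 1) ω ^ 2 + X ((n + j : ℕ) + 1) ω ^ 2)) μ :=
    integrable_finsetSum _ fun j _ => hsi j
  have hBi := integrable_finsetSum (Finset.range n) fun k _ => hbi k
  calc _ ≤ ∫ ω, 1 / (n : ℝ) * (∑ k ∈ Finset.range n,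
          |1 / (m : ℝ) * ∑ j ∈ Finset.range m, X ((k + j : ℕ) + 1) ω ^ 2 - b| +
        ∑ j ∈ Finset.range m, (X (j + 1) ω ^ 2 + X ((n + j : ℕ) + 1) ω ^ 2)) ∂μ :=
        integral_mono_of_nonneg (.of_forall fun ω => abs_nonneg _)
          ((hBi.add hEi).const_mul _) (.of_forall fun ω =>
            abs_mean_sub_le (q := fun k : ℕ => X (k + 1) ω ^ 2) (fun _ => sq_nonneg _) b hm hn)
    _ = 1 / (n : ℝ) * (n * ∫ ω, |1 / (m : ℝ) * ∑ j ∈ Finset.range m, X (j + 1) ω ^ 2 - b| ∂μ +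
          m * (∫ ω, X 1 ω ^ 2 ∂μ + ∫ ω, X 1 ω ^ 2 ∂μ)) := by
        rw [integral_const_mul, integral_add hBi hEi, integral_finsetSum _ fun k _ => hbi k,
          integral_finsetSum _ fun j _ => hsi j]
        congr 2
        · rw [Finset.sum_congr rfl fun k _ => hbe k, Finset.sum_const, Finset.card_range,
            nsmul_eq_mul]
        · rw [Finset.sum_congr rfl fun j _ => (integral_add (hi j) (hi (n + j))).trans
            (by rw [he, he]), Finset.sum_const, Finset.card_range, nsmul_eq_mul]
    _ = _ := by field_simp; ring

/-- The `L¹` law of large numbers for the squares of a stationary triangular array whose weak limits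
satisfy it. -/
theorem tendsto_integral_abs_mean_sq_sub [IsProbabilityMeasure μ] {Ω' : Type*}
    {mΩ' : MeasurableSpace Ω'}
    {μ' : Measure Ω'} [IsProbabilityMeasure μ'] {D : ℕ → ℤ → Ω → ℝ} {L : ℕ → Ω' → ℝ} {b : ℝ}
    (hb : 0 ≤ b) (hstat : ∀ n, IsStationarySequence (D n) μ)
    (hUI : UniformIntegrable (fun (n : ℕ) (ω : Ω) => (D n 1 ω) ^ 2) 1 μ)
    (hL : ∀ m : ℕ, 1 ≤ m →
      TendstoInDistribution
        (fun (n : ℕ) (ω : Ω) (i : Fin m) => D n ((i : ℤ) + 1) ω) atTop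
        (fun (ω : Ω') (i : Fin m) => L ((i : ℕ) + 1) ω) (fun _ => μ) μ')
    (herg : Tendsto
      (fun m : ℕ => eLpNorm
        (fun ω : Ω' => ((1 / (m : ℝ)) * ∑ j ∈ Finset.Icc 1 m, (L j ω) ^ 2) - b) 1 μ')
      atTop (𝓝 0)) :
    Tendsto (fun n : ℕ => ∫ ω, |1 / (n : ℝ) * ∑ k ∈ Finset.range n, D n (k + 1) ω ^ 2 - b| ∂μ)
      atTop (𝓝 0) := by
  rw [Metric.tendsto_atTop']
  intro ε hε
  obtain ⟨B, hB0, hB⟩ := exists_forall_integral_le hUI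
  -- Error budget: tail `ε/4`, block deviation `2 · ε/8`, boundary below `ε/2`. The length `m` is
  -- fixed before `n` grows.
  obtain ⟨A, hA0, hbA, hA⟩ := exists_forall_integral_max_sub_le hUI b (half_pos (half_pos hε))
  have hD2 : ∀ n, Integrable (fun ω => D n 1 ω ^ 2) μ := fun n =>
    memLp_one_iff_integrable.1 (hUI.memLp n)
  have hδ : 0 < ε / 8 := by positivity
  obtain ⟨m, hmL, hm⟩ := ((herg.eventually_le_const (ENNReal.ofReal_pos.2 hδ)).and
    (eventually_ge_atTop 1)).exists
  rw [eLpNorm_one_eq_lintegral_enorm] at hmL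
  have hLm : ∫⁻ ω, ‖1 / (m : ℝ) * ∑ i : Fin m, L ((i : ℕ) + 1) ω ^ 2 - b‖ₑ ∂μ' ≤
      ENNReal.ofReal (ε / 8) := by
    refine le_trans (le_of_eq ?_) hmL
    congr with ω
    rw [Fin.sum_univ_eq_sum_range (fun i => L (i + 1) ω ^ 2) m, Finset.range_eq_Ico,
      Finset.sum_Ico_add' (fun i => L i ω ^ 2) 0 m 1]
    rfl
  have hev := eventually_integral_abs_mean_sq_sub_le hm (hL m hm)
    (fun n i => ((hstat n).identDistrib_one _).sq.symm.integrable_snd (hD2 n)) hb hbA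
    (fun n i => by
      have hu : Measurable fun x : ℝ => max (x ^ 2 - A) 0 := by fun_prop
      exact (((hstat n).identDistrib_one ((i : ℤ) + 1)).comp hu).integral_eq.trans_le (hA n))
    hδ hLm
  have hlim : Tendsto (fun n : ℕ => 2 * m / n * B) atTop (𝓝 0) := by
    simpa using (tendsto_const_div_atTop_nhds_zero_nat (2 * m : ℝ)).mul_const B
  obtain ⟨N, hN⟩ := eventually_atTop.1 ((hev.and (hlim.eventually_lt_const (half_pos hε))).and
    (eventually_ge_atTop 1))
  refine ⟨N, fun n hn => ?_⟩
  obtain ⟨⟨h1, h2⟩, h3⟩ := hN n hn.le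
  rw [Real.dist_eq, sub_zero, abs_of_nonneg (integral_nonneg fun ω => abs_nonneg _)]
  have h4 := (hstat n).integral_abs_mean_sq_sub_le (hD2 n) b hm h3
  have h5 : 2 * m / n * ∫ ω, D n 1 ω ^ 2 ∂μ ≤ 2 * m / n * B := by gcongr; exact hB n
  have h6 : ∀ ω, ∑ i : Fin m, D n ((i : ℤ) + 1) ω ^ 2 =
      ∑ j ∈ Finset.range m, D n ((j : ℤ) + 1) ω ^ 2 := fun ω =>
    Fin.sum_univ_eq_sum_range (fun j => D n ((j : ℤ) + 1) ω ^ 2) m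
  simp only [h6] at h1
  linarith

end

/-! ### Characteristic functions and conclusion. -/

/-- The filtration `(ℱ k)_{k ∈ ℤ}` restricted to the natural numbers. -/
def natFiltration {Ω : Type*} {mΩ : MeasurableSpace Ω} (ℱ : Filtration ℤ mΩ) :
    Filtration ℕ mΩ where
  seq k := ℱ (k : ℤ)
  mono' _ _ h := ℱ.mono (by exact_mod_cast h)
  le' k := ℱ.le k

/-- McLeish's inequality for `Y k = (t/√n) D (k + 1)` and `a = t²c²/2`. The index shift makes `Y k`
measurable at time `k + 1` and centred given time `k`; stationarity makes all Lindeberg terms equal.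
-/
lemma norm_charFun_sub_exp_le {Ω : Type*} {mΩ : MeasurableSpace Ω} {μ : Measure Ω}
    [IsProbabilityMeasure μ] {D : ℤ → Ω → ℝ} {ℱ : Filtration ℤ mΩ}
    (hstat : IsStationarySequence D μ) (hmds : IsMartingaleDifferenceSequence D ℱ μ)
    (hD2 : Integrable (fun ω => D 1 ω ^ 2) μ) (c t : ℝ) {n : ℕ} (hn : 1 ≤ n) :
    ‖charFun (μ.map fun ω => (1 / √(n : ℝ)) * ∑ k ∈ Finset.Icc 1 n, D (k : ℤ) ω) t -
        (Real.exp (-(t ^ 2 * c ^ 2 / 2)) : ℂ)‖ ≤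
      (20 * Real.exp (t ^ 2 * c ^ 2 / 2 + 2) + Real.exp 2 * (t ^ 2 * c ^ 2 / 2 + 3)) *
        (n * ∫ ω, lindebergRem (t / √n * D 1 ω) ∂μ +
          t ^ 2 / 2 * ∫ ω, |1 / (n : ℝ) * ∑ k ∈ Finset.range n, D (k + 1) ω ^ 2 - c ^ 2| ∂μ) := by
  have hn0 : (0 : ℝ) < n := by exact_mod_cast hn
  have hDm : ∀ k, Measurable (D k) := fun k => (hmds.adapted k).mono (ℱ.le k) le_rfl
  have hmain := norm_integral_exp_sum_sub_exp_le (μ := μ) (ℱ := natFiltration ℱ)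
    (Y := fun k ω => t / √n * D (k + 1) ω)
    (fun k => by
      have h := hmds.adapted ((k : ℤ) + 1)
      have h' : natFiltration ℱ (k + 1) = ℱ ((k : ℤ) + 1) := by simp [natFiltration]
      rw [h']
      exact h.const_mul _)
    (fun k => (hmds.integrable _).const_mul _)
    (fun k => by
      simp only [mul_pow]
      exact (((hstat.identDistrib_one _).sq.symm.integrable_snd hD2).const_mul _))
    (fun k => by
      have h := hmds.condExp_eq_zero ((k : ℤ) + 1)
      rw [add_sub_cancel_right] at h
      have h1 := condExp_smul (μ := μ) (t / √n) (D ((k : ℤ) + 1)) (ℱ (k : ℤ))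
      refine h1.trans ?_
      filter_upwards [h] with ω hω
      simp [hω])
    (a := t ^ 2 * c ^ 2 / 2) (by positivity) n
  have hsum : ∀ ω, ∑ k ∈ Finset.Icc 1 n, D (k : ℤ) ω = ∑ k ∈ Finset.range n, D (k + 1) ω := by
    intro ω
    rw [Finset.range_eq_Ico]
    have h := Finset.sum_Ico_add' (fun i : ℕ => D (i : ℤ) ω) 0 n 1
    push_cast at h
    rw [h]
    rfl
  have h1 : charFun (μ.map fun ω => (1 / √(n : ℝ)) * ∑ k ∈ Finset.Icc 1 n, D (k : ℤ) ω) t =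
      ∫ ω, Complex.exp (Complex.I * (∑ j ∈ Finset.range n, t / √n * D (j + 1) ω : ℝ)) ∂μ := by
    have hm : Measurable fun ω => (1 / √(n : ℝ)) * ∑ k ∈ Finset.Icc 1 n, D (k : ℤ) ω :=
      (Finset.measurable_fun_sum _ fun (k : ℕ) _ => hDm k).const_mul _
    rw [charFun_apply_real, integral_map hm.aemeasurable
      (Measurable.aestronglyMeasurable (by fun_prop))]
    congr with ω
    rw [← Finset.mul_sum, hsum]
    congr 1
    push_cast
    ring
  have h2 : ∑ k ∈ Finset.range n, ∫ ω, lindebergRem (t / √n * D (k + 1) ω) ∂μ =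
      n * ∫ ω, lindebergRem (t / √n * D 1 ω) ∂μ := by
    have hu : Measurable fun x : ℝ => lindebergRem (t / √n * x) := by fun_prop
    have he (k : ℕ) : ∫ ω, lindebergRem (t / √n * D (k + 1) ω) ∂μ =
        ∫ ω, lindebergRem (t / √n * D 1 ω) ∂μ :=
      ((hstat.identDistrib_one ((k : ℤ) + 1)).comp hu).integral_eq
    simp only [he, Finset.sum_const, Finset.card_range, nsmul_eq_mul]
  have h3 : ∫ ω, |∑ j ∈ Finset.range n, (t / √n * D (j + 1) ω) ^ 2 / 2 - t ^ 2 * c ^ 2 / 2| ∂μ =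
      t ^ 2 / 2 * ∫ ω, |1 / (n : ℝ) * ∑ k ∈ Finset.range n, D (k + 1) ω ^ 2 - c ^ 2| ∂μ := by
    rw [← integral_const_mul]
    congr with ω
    have he : ∑ j ∈ Finset.range n, (t / √n * D (j + 1) ω) ^ 2 / 2 - t ^ 2 * c ^ 2 / 2 =
        t ^ 2 / 2 * (1 / (n : ℝ) * ∑ k ∈ Finset.range n, D (k + 1) ω ^ 2 - c ^ 2) := by
      simp only [mul_pow, div_pow, Real.sq_sqrt hn0.le]
      rw [← Finset.sum_div, ← Finset.mul_sum]
      field_simp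
    rw [he, abs_mul, abs_of_nonneg (by positivity : 0 ≤ t ^ 2 / 2)]
  rw [h1, ← h2, ← h3]
  exact hmain

lemma charFun_map_const_mul_gaussian {Ω : Type*} {mΩ : MeasurableSpace Ω} {μ : Measure Ω}
    {Z : Ω → ℝ} (hZ : HasLaw Z (gaussianReal 0 1) μ) (c t : ℝ) :
    charFun (μ.map fun ω => c * Z ω) t = (Real.exp (-(t ^ 2 * c ^ 2 / 2)) : ℂ) := by
  rw [charFun_map_mul_comp hZ.aemeasurable, hZ.map_eq, charFun_gaussianReal]
  push_cast
  congr 1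
  simp
  ring

theorem mainTheorem3
    {Ω : Type*} {mΩ : MeasurableSpace Ω} (μ : Measure Ω) [IsProbabilityMeasure μ]
    {Ω' : Type*} {mΩ' : MeasurableSpace Ω'} (μ' : Measure Ω') [IsProbabilityMeasure μ']
    {Ω'' : Type*} {mΩ'' : MeasurableSpace Ω''} (μ'' : Measure Ω'') [IsProbabilityMeasure μ'']
    (D : ℕ → ℤ → Ω → ℝ) (ℱ : ℕ → Filtration ℤ mΩ)
    (L : ℕ → Ω' → ℝ) (c : ℝ) (Z : Ω'' → ℝ)
    (hstat : ∀ n, IsStationarySequence (D n) μ)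
    (hmds : ∀ n, IsMartingaleDifferenceSequence (D n) (ℱ n) μ)
    (hUI : UniformIntegrable (fun (n : ℕ) (ω : Ω) => (D n 1 ω) ^ 2) 1 μ)
    (hL : ∀ m : ℕ, 1 ≤ m →
      TendstoInDistribution
        (fun (n : ℕ) (ω : Ω) (i : Fin m) => D n ((i : ℤ) + 1) ω) atTop
        (fun (ω : Ω') (i : Fin m) => L ((i : ℕ) + 1) ω) (fun _ => μ) μ')
    (herg : Tendsto
      (fun m : ℕ => eLpNorm
        (fun ω : Ω' => ((1 / (m : ℝ)) * ∑ j ∈ Finset.Icc 1 m, (L j ω) ^ 2) - c ^ 2) 1 μ')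
      atTop (𝓝 0))
    (hZ : HasLaw Z (gaussianReal 0 1) μ'') :
    TendstoInDistribution
      (fun (n : ℕ) (ω : Ω) => (1 / √(n : ℝ)) * ∑ k ∈ Finset.Icc 1 n, D n (k : ℤ) ω) atTop
      (fun ω : Ω'' => c * Z ω) (fun _ => μ) μ'' := by
  have hS (n : ℕ) : AEMeasurable
      (fun ω => (1 / √(n : ℝ)) * ∑ k ∈ Finset.Icc 1 n, D n (k : ℤ) ω) μ :=
    ((Finset.measurable_fun_sum _ fun (k : ℕ) _ =>
      ((hmds n).adapted k).mono ((ℱ n).le k) le_rfl).const_mul _).aemeasurable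
  refine ⟨hS, hZ.aemeasurable.const_mul c, ?_⟩
  refine ProbabilityMeasure.tendsto_iff_tendsto_charFun.2 fun t => ?_
  simp only [ProbabilityMeasure.coe_mk, charFun_map_const_mul_gaussian hZ]
  rw [tendsto_iff_norm_sub_tendsto_zero]
  have hlln := tendsto_integral_abs_mean_sq_sub (sq_nonneg c) hstat hUI hL herg
  have hlin := tendsto_nat_mul_integral_lindebergRem hUI t
  -- The prefactor in the bound depends only on `t` and `c`, so both error terms vanish in the
  -- limit.
  refine squeeze_zero' (.of_forall fun n => norm_nonneg _)
    ((eventually_ge_atTop 1).mono fun n hn => norm_charFun_sub_exp_le (hstat n) (hmds n)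
      (memLp_one_iff_integrable.1 (hUI.memLp n)) c t hn) ?_
  simpa using (hlin.add (hlln.const_mul (t ^ 2 / 2))).const_mul
    (20 * Real.exp (t ^ 2 * c ^ 2 / 2 + 2) + Real.exp 2 * (t ^ 2 * c ^ 2 / 2 + 3))
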